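/- Let $\nu>-1$. For $k=0,1,2,\dots$ let $\mathbb{L}^{\nu}_k=\sqrt{k!/\Gamma(k+\nu+1)}\,L^{\nu}_k$ be the orthonormal Laguerre polynomials with respect to the weight $x^{\nu}e^{-x}$ on $\mathbf{R}^{+}=(0,\infty)$, where $L^{\nu}_k(x)=\sum_{j=0}^{k}(-1)^j\binom{k+\nu}{k-j}\frac{x^j}{j!}$, and for $f:\mathbf{R}^{+}\to\mathbb{C}$ put $$f_k=\int_0^\infty f(x)\,\mathbb{L}^{\nu}_k(x)\,x^{\nu}e^{-x}\,dx .$$ Then the following are equivalent: (i) $f\in L^2(\mathbf{R}^{+},x^{\nu}e^{-x}dx)$ and $\sum_{k=0}^{\infty}|f_k|^2\theta^k<\infty$ for all $\theta>1$; (ii) $f$ coincides almost everywhere on $\mathbf{R}^{+}$ with the restriction to $\mathbf{R}^{+}$ of an entire function $F$ such that for every $\varepsilon>0$ there is a constant $C=C(\varepsilon)$, independent of $z$, with $|F(z)|\le C e^{\varepsilon|z|}$ for all $z\in\mathbb{C}$. In particular, for $f\in L^2(\mathbf{R}^{+},x^{\nu}e^{-x}dx)$ the series $\sum_k|f_k|^2\theta^k$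 converges for all $\theta>1$ if and only if (ii) holds. -/

import Mathlib

open MeasureTheory Set

noncomputable section

/-- The generalized Laguerre polynomial `L_k^ν` in its standard normalization,
`L_k^ν(x) = ∑_{j=0}^k (-1)^j * binom(k+ν, k-j) * x^j / j!`, where
`binom(k+ν, k-j) = Γ(k+ν+1) / ((k-j)! Γ(j+ν+1))`. -/
def laguerrePoly (ν : ℝ) (k : ℕ) (x : ℝ) : ℝ :=
  ∑ j ∈ Finset.range (k + 1),
    (-1) ^ j * (Real.Gamma (k + ν + 1) / ((k - j).factorial * Real.Gamma (j + ν + 1))) *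
      (x ^ j / j.factorial)

/-- The orthonormal Laguerre polynomial: `L_k^ν` divided by its norm
`(Γ(k+ν+1) / k!)^(1/2)` in `L²((0,∞), x^ν e^{-x} dx)`. -/
def laguerreOrthonormal (ν : ℝ) (k : ℕ) (x : ℝ) : ℝ :=
  laguerrePoly ν k x / Real.sqrt (Real.Gamma (k + ν + 1) / k.factorial)

/-- The Laguerre weight `x^ν e^{-x}`. -/
def laguerreWeight (ν : ℝ) (x : ℝ) : ℝ := x ^ ν * Real.exp (-x)

/-- The measure `x^ν e^{-x} dx` on `(0,∞)`. -/
def laguerreMeasure (ν : ℝ) : Measure ℝ :=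
  (volume.restrict (Ioi 0)).withDensity fun x => ENNReal.ofReal (laguerreWeight ν x)

/-- The `k`-th Fourier-Laguerre coefficient
`∫_0^∞ f(x) 𝕃_k^ν(x) x^ν e^{-x} dx` of `f`. -/
def laguerreCoeff (ν : ℝ) (f : ℝ → ℂ) (k : ℕ) : ℂ :=
  ∫ x in Ioi (0 : ℝ), f x * (laguerreOrthonormal ν k x : ℂ) * (laguerreWeight ν x : ℂ)

end

/-! Since θ is arbitrary, summability of |f_k|² θ^k for all θ > 1 says that |f_k| = O(q⁻ᵏ) for every
q > 1, so any fixed factor B^k is harmless and crude estimates suffice.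

(ii) ⇒ (i): Cauchy's estimates make F⁽ⁿ⁾(0) = O(ηⁿ) for every η > 0. The Taylor polynomial of degree
< k is orthogonal to the k-th Laguerre polynomial, so f_k only sees the Taylor remainder, which is
O(δ^k e^{|z|/4}) with δ as small as desired (`norm_sub_taylor_le`, `exists_norm_laguerreCoeff_le`).

(i) ⇒ (ii): `exists_norm_laguerreEntire_le` bounds the k-th polynomial by B (B/η)^k e^{η|z|} for
each small η, so the Laguerre series of f converges locally uniformly to an entire function of
minimal exponential type. It has the same coefficients as f, and completeness, proved through moment
determinacy, makes the two agree almost everywhere. -/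

open ProbabilityTheory Filter Topology

/-! ### Moment determinacy and completeness of polynomials. -/

/-- Finite measures on `ℝ` with exponential moments are determined by their moments. -/
theorem measure_ext_of_moments {μ₁ μ₂ : Measure ℝ} [IsFiniteMeasure μ₁] [IsFiniteMeasure μ₂]
    {c : ℝ} (hc : 0 < c)
    (h₁ : Ioo (-c) c ⊆ integrableExpSet id μ₁) (h₂ : Ioo (-c) c ⊆ integrableExpSet id μ₂)
    (h : ∀ n : ℕ, ∫ x, x ^ n ∂μ₁ = ∫ x, x ^ n ∂μ₂) : μ₁ = μ₂ := by
  have i₁ : Ioo (-c) c ⊆ interior (integrableExpSet id μ₁) := interior_maximal h₁ isOpen_Ioo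
  have i₂ : Ioo (-c) c ⊆ interior (integrableExpSet id μ₂) := interior_maximal h₂ isOpen_Ioo
  set U : Set ℂ := {z | z.re ∈ Ioo (-c) c} with hU
  have a₁ : AnalyticOnNhd ℂ (complexMGF id μ₁) U := fun z hz => analyticAt_complexMGF (i₁ hz)
  have a₂ : AnalyticOnNhd ℂ (complexMGF id μ₂) U := fun z hz => analyticAt_complexMGF (i₂ hz)
  have h0 : (0 : ℂ) ∈ U := by simp [hU, hc]
  -- The derivatives of the moment generating function at 0 are the moments, so both functions have
  -- the same Taylor series there.
  have hder : ∀ n, iteratedDeriv n (complexMGF id μ₁) 0 = iteratedDeriv n (complexMGF id μ₂) 0 := by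
    intro n
    rw [iteratedDeriv_complexMGF (i₁ h0), iteratedDeriv_complexMGF (i₂ h0)]
    have key : ∀ μ : Measure ℝ, ∫ x, ((id x : ℝ) : ℂ) ^ n * Complex.exp (0 * (id x : ℝ)) ∂μ
        = ((∫ x, x ^ n ∂μ : ℝ) : ℂ) := by
      intro μ
      rw [← integral_complex_ofReal]
      simp
    rw [key, key, h]
  have hev : complexMGF id μ₁ =ᶠ[𝓝 0] complexMGF id μ₂ := by
    have p₁ := (a₁ 0 h0).hasFPowerSeriesAt
    have p₂ := (a₂ 0 h0).hasFPowerSeriesAt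
    simp only [hder] at p₁
    filter_upwards [p₁.eventually_hasSum_sub, p₂.eventually_hasSum_sub] with z hz₁ hz₂
    exact hz₁.unique hz₂
  have hconn : IsPreconnected U := by
    have : Convex ℝ U := (convex_Ioo (-c) c).linear_preimage Complex.reLm
    exact this.isPreconnected
  have heq := a₁.eqOn_of_preconnected_of_eventuallyEq a₂ hconn h0 hev
  refine Measure.ext_of_charFun ?_
  ext t
  -- The imaginary axis lies in the strip `U`, and there the generating function is the
  -- characteristic function.
  rw [← complexMGF_id_mul_I, ← complexMGF_id_mul_I]
  exact heq (by simp [hU, hc])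

/-- Polynomials are complete in `L²(μ)` if `μ` has exponential moments: real version. -/
theorem ae_eq_zero_of_real_moments {μ : Measure ℝ} [IsFiniteMeasure μ] {c : ℝ} (hc : 0 < c)
    (hexp : ∀ t ∈ Ioo (-c) c, Integrable (fun x => Real.exp (t * x)) μ)
    {g : ℝ → ℝ} (hg : MemLp g 2 μ) (h : ∀ n : ℕ, ∫ x, x ^ n * g x ∂μ = 0) : g =ᵐ[μ] 0 := by
  have hgi : Integrable g μ := hg.integrable one_le_two
  -- Cauchy–Schwarz against an L² density needs e^{2tx} integrable, which halves the strip.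
  have hexp2 : ∀ t ∈ Ioo (-(c / 2)) (c / 2), MemLp (fun x => Real.exp (t * x)) 2 μ := by
    intro t ht
    rw [memLp_two_iff_integrable_sq (by fun_prop)]
    convert! hexp (2 * t) ⟨by linarith [ht.1], by linarith [ht.2]⟩ using 2 with x
    rw [← Real.exp_nat_mul]; push_cast; ring_nf
  have hmeas : ∀ {u : ℝ → ℝ}, MemLp u 2 μ → AEMeasurable (fun x => ENNReal.ofReal (u x)) μ :=
    fun hu => hu.1.aemeasurable.ennreal_ofReal
  have hfin : ∀ {u : ℝ → ℝ}, MemLp u 2 μ →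
      IsFiniteMeasure (μ.withDensity fun x => ENNReal.ofReal (u x)) :=
    fun hu => isFiniteMeasure_withDensity_ofReal (hu.integrable one_le_two).2
  have hint : ∀ {u : ℝ → ℝ}, MemLp u 2 μ → Ioo (-(c / 2)) (c / 2) ⊆
      integrableExpSet id (μ.withDensity fun x => ENNReal.ofReal (u x)) := by
    intro u hu t ht
    rw [integrableExpSet, mem_ofPred_eq, integrable_withDensity_iff_integrable_smul₀' (hmeas hu)
      (ae_of_all _ fun x => ENNReal.ofReal_lt_top)]
    refine ((hexp2 t ht).integrable_mul hu.pos_part).congr (ae_of_all _ fun x => ?_)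
    simp [mul_comm, ENNReal.toReal_ofReal']
  have := hfin hg
  have := hfin hg.neg
  have hpow : ∀ {u : ℝ → ℝ}, MemLp u 2 μ → ∀ n : ℕ, Integrable (fun x => x ^ n * max (u x) 0) μ := by
    intro u hu n
    have := hfin hu
    have h0 : (0 : ℝ) ∈ interior
        (integrableExpSet id (μ.withDensity fun x => ENNReal.ofReal (u x))) :=
      interior_maximal (hint hu) isOpen_Ioo ⟨by linarith, by linarith⟩
    have := integrable_pow_of_mem_interior_integrableExpSet h0 n
    rw [integrable_withDensity_iff_integrable_smul₀' (hmeas hu)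
      (ae_of_all _ fun x => ENNReal.ofReal_lt_top)] at this
    refine this.congr (ae_of_all _ fun x => ?_)
    simp [mul_comm, ENNReal.toReal_ofReal']
  have hmom : ∀ {u : ℝ → ℝ}, MemLp u 2 μ → ∀ n : ℕ,
      ∫ x, x ^ n ∂(μ.withDensity fun x => ENNReal.ofReal (u x)) = ∫ x, x ^ n * max (u x) 0 ∂μ := by
    intro u hu n
    rw [integral_withDensity_eq_integral_toReal_smul₀ (hmeas hu)
      (ae_of_all _ fun x => ENNReal.ofReal_lt_top)]
    simp [mul_comm, ENNReal.toReal_ofReal']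
  -- `ENNReal.ofReal` truncates at 0, so these are the measures with densities g⁺ and g⁻; vanishing
  -- moments of g mean that their moments agree.
  have heq : μ.withDensity (fun x => ENNReal.ofReal (g x))
      = μ.withDensity (fun x => ENNReal.ofReal ((-g) x)) := by
    refine measure_ext_of_moments (half_pos hc) (hint hg) (hint hg.neg) fun n => ?_
    rw [hmom hg, hmom hg.neg, ← sub_eq_zero, ← integral_sub (hpow hg n) (hpow hg.neg n)]
    refine Eq.trans ?_ (h n)
    congr 1 with x
    rw [← mul_sub, Pi.neg_apply]
    congr 1
    exact posPart_sub_negPart (g x)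
  rw [withDensity_eq_iff (hmeas hg) (hmeas hg.neg)
    ((hasFiniteIntegral_iff_norm _).1 hgi.2 |>.trans_le' (lintegral_mono fun x =>
      ENNReal.ofReal_le_ofReal (le_abs_self _)) |>.ne)] at heq
  filter_upwards [heq] with x hx
  have := congrArg ENNReal.toReal hx
  simp only [ENNReal.toReal_ofReal', Pi.neg_apply] at this
  simp only [Pi.zero_apply]
  rcases le_total (g x) 0 with h' | h'
  · rw [max_eq_right h', max_eq_left (by linarith)] at this; linarith
  · rw [max_eq_left h', max_eq_right (by linarith)] at this; linarith

/-- Polynomials are complete in `L²(μ)` if `μ` has exponential moments. -/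
theorem ae_eq_zero_of_moments {μ : Measure ℝ} [IsFiniteMeasure μ] {c : ℝ} (hc : 0 < c)
    (hexp : ∀ t ∈ Ioo (-c) c, Integrable (fun x => Real.exp (t * x)) μ)
    {g : ℝ → ℂ} (hg : MemLp g 2 μ) (hpow : ∀ n : ℕ, Integrable (fun x : ℝ => (x : ℂ) ^ n * g x) μ)
    (h : ∀ n : ℕ, ∫ x, (x : ℂ) ^ n * g x ∂μ = 0) : g =ᵐ[μ] 0 := by
  have hre : ∀ (n : ℕ) (x : ℝ), ((x : ℂ) ^ n * g x).re = x ^ n * (g x).re := by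
    intro n x; rw [← Complex.ofReal_pow, Complex.re_ofReal_mul]
  have him : ∀ (n : ℕ) (x : ℝ), ((x : ℂ) ^ n * g x).im = x ^ n * (g x).im := by
    intro n x; rw [← Complex.ofReal_pow, Complex.im_ofReal_mul]
  have r := ae_eq_zero_of_real_moments hc hexp hg.re fun n => by
    have := integral_re (hpow n)
    simp only [RCLike.re_eq_complex_re, hre, h, Complex.zero_re] at this
    exact this
  have i := ae_eq_zero_of_real_moments hc hexp hg.im fun n => by
    have := integral_im (hpow n)
    simp only [RCLike.im_eq_complex_im, him, h, Complex.zero_im] at this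
    exact this
  filter_upwards [r, i] with x hr hi
  exact Complex.ext hr hi

/-! ### The Laguerre measure and its moments. -/

theorem measurable_laguerreWeight (ν : ℝ) : Measurable (laguerreWeight ν) := by
  unfold laguerreWeight; fun_prop

theorem laguerreWeight_pos (ν : ℝ) {x : ℝ} (hx : 0 < x) : 0 < laguerreWeight ν x :=
  mul_pos (Real.rpow_pos_of_pos hx _) (Real.exp_pos _)

theorem integral_laguerreMeasure (ν : ℝ) {E : Type*} [NormedAddCommGroup E] [NormedSpace ℝ E]
    (g : ℝ → E) :
    ∫ x, g x ∂(laguerreMeasure ν) = ∫ x in Ioi (0 : ℝ), laguerreWeight ν x • g x := by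
  rw [laguerreMeasure, integral_withDensity_eq_integral_toReal_smul
    (measurable_laguerreWeight ν).ennreal_ofReal (ae_of_all _ fun x => ENNReal.ofReal_lt_top)]
  refine setIntegral_congr_fun measurableSet_Ioi fun x hx => ?_
  simp only [ENNReal.toReal_ofReal (laguerreWeight_pos ν hx).le]

theorem integrable_laguerreMeasure_iff (ν : ℝ) {E : Type*} [NormedAddCommGroup E] [NormedSpace ℝ E]
    (g : ℝ → E) :
    Integrable g (laguerreMeasure ν) ↔ IntegrableOn (fun x => laguerreWeight ν x • g x) (Ioi 0) := by
  rw [laguerreMeasure, integrable_withDensity_iff_integrable_smul'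
    (measurable_laguerreWeight ν).ennreal_ofReal (ae_of_all _ fun x => ENNReal.ofReal_lt_top)]
  refine integrableOn_congr_fun (fun x hx => ?_) measurableSet_Ioi
  simp only [ENNReal.toReal_ofReal (laguerreWeight_pos ν hx).le]

theorem ae_laguerreMeasure_iff (ν : ℝ) {p : ℝ → Prop} :
    (∀ᵐ x ∂(laguerreMeasure ν), p x) ↔ ∀ᵐ x ∂(volume.restrict (Ioi (0 : ℝ))), p x := by
  rw [laguerreMeasure, ae_withDensity_iff (measurable_laguerreWeight ν).ennreal_ofReal]
  have hpos : ∀ᵐ x ∂(volume.restrict (Ioi (0 : ℝ))), 0 < x := ae_restrict_mem measurableSet_Ioi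
  constructor
  · intro h
    filter_upwards [h, hpos] with x hx h0
    exact hx (by simpa using laguerreWeight_pos ν h0)
  · intro h
    filter_upwards [h] with x hx _ using hx

theorem ae_pos_laguerreMeasure (ν : ℝ) : ∀ᵐ x ∂(laguerreMeasure ν), 0 < x :=
  (ae_laguerreMeasure_iff ν).2 (ae_restrict_mem measurableSet_Ioi)

theorem laguerreCoeff_eq (ν : ℝ) (f : ℝ → ℂ) (k : ℕ) :
    laguerreCoeff ν f k = ∫ x, f x * (laguerreOrthonormal ν k x : ℂ) ∂(laguerreMeasure ν) := by
  rw [integral_laguerreMeasure, laguerreCoeff]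
  congr 1 with x
  rw [Complex.real_smul]; ring

theorem integrable_exp_laguerreMeasure {ν : ℝ} (hν : -1 < ν) {t : ℝ} (ht : t < 1) :
    Integrable (fun x => Real.exp (t * x)) (laguerreMeasure ν) := by
  rw [integrable_laguerreMeasure_iff]
  refine (integrableOn_rpow_mul_exp_neg_mul_rpow (p := 1) (b := 1 - t) hν one_pos
    (by linarith)).congr_fun (fun x _ => ?_) measurableSet_Ioi
  simp only [laguerreWeight, smul_eq_mul, Real.rpow_one, mul_assoc, ← Real.exp_add]
  ring_nf

theorem isFiniteMeasure_laguerreMeasure {ν : ℝ} (hν : -1 < ν) :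
    IsFiniteMeasure (laguerreMeasure ν) := by
  have := integrable_exp_laguerreMeasure hν (t := 0) one_pos
  simp only [zero_mul, Real.exp_zero] at this
  exact (integrable_const_iff_isFiniteMeasure one_ne_zero).1 this

theorem integrable_pow_laguerreMeasure {ν : ℝ} (hν : -1 < ν) (n : ℕ) :
    Integrable (fun x => x ^ n) (laguerreMeasure ν) := by
  have hsub : Iio 1 ⊆ integrableExpSet id (laguerreMeasure ν) :=
    fun t ht => integrable_exp_laguerreMeasure hν ht
  exact integrable_pow_of_mem_interior_integrableExpSet
    (interior_maximal hsub isOpen_Iio (show (0 : ℝ) < 1 from one_pos)) n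

theorem integral_pow_laguerreMeasure {ν : ℝ} (hν : -1 < ν) (n : ℕ) :
    ∫ x, x ^ n ∂(laguerreMeasure ν) = Real.Gamma (n + ν + 1) := by
  have : (0 : ℝ) < n + ν + 1 := by have : (0 : ℝ) ≤ n := n.cast_nonneg; linarith
  rw [integral_laguerreMeasure, Real.Gamma_eq_integral this]
  refine setIntegral_congr_fun measurableSet_Ioi fun x hx => ?_
  simp only [laguerreWeight, smul_eq_mul]
  rw [show (n : ℝ) + ν + 1 - 1 = ν + n by ring, Real.rpow_add hx, Real.rpow_natCast]
  ring

/-! ### Coefficients and growth of the orthonormal Laguerre polynomials. -/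

noncomputable section

/-- The squared norm `Γ(k+ν+1) / k!` of the `k`-th Laguerre polynomial. -/
def laguerreNormSq (ν : ℝ) (k : ℕ) : ℝ := Real.Gamma (k + ν + 1) / k.factorial

/-- The coefficient of `x ^ j` in the `k`-th orthonormal Laguerre polynomial. -/
def laguerreOrthonormalCoeff (ν : ℝ) (k j : ℕ) : ℝ :=
  (-1) ^ j * (√(laguerreNormSq ν k) / laguerreNormSq ν j * k.choose j / j.factorial)

/-- The orthonormal Laguerre polynomial as an entire function. -/
def laguerreEntire (ν : ℝ) (k : ℕ) (z : ℂ) : ℂ :=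
  ∑ j ∈ Finset.range (k + 1), (laguerreOrthonormalCoeff ν k j : ℂ) * z ^ j

end

theorem natCast_add_nu_pos {ν : ℝ} (hν : -1 < ν) (k : ℕ) : (0 : ℝ) < k + ν + 1 := by
  have : (0 : ℝ) ≤ k := k.cast_nonneg
  linarith

theorem laguerreNormSq_pos {ν : ℝ} (hν : -1 < ν) (k : ℕ) : 0 < laguerreNormSq ν k :=
  div_pos (Real.Gamma_pos_of_pos (natCast_add_nu_pos hν k)) (by positivity)

theorem laguerreOrthonormal_eq_sum {ν : ℝ} (hν : -1 < ν) (k : ℕ) (x : ℝ) :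
    laguerreOrthonormal ν k x
      = ∑ j ∈ Finset.range (k + 1), laguerreOrthonormalCoeff ν k j * x ^ j := by
  rw [laguerreOrthonormal, laguerrePoly, Finset.sum_div]
  refine Finset.sum_congr rfl fun j hj => ?_
  have hjk : j ≤ k := Nat.lt_succ_iff.1 (Finset.mem_range.1 hj)
  have hk := laguerreNormSq_pos hν k
  have hs : √(laguerreNormSq ν k) ≠ 0 := (Real.sqrt_pos.2 hk).ne'
  have hG : Real.Gamma (k + ν + 1) = √(laguerreNormSq ν k) * √(laguerreNormSq ν k) * k.factorial := by
    rw [Real.mul_self_sqrt hk.le, laguerreNormSq]; field_simp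
  have hΓ := (Real.Gamma_pos_of_pos (natCast_add_nu_pos hν j)).ne'
  rw [laguerreOrthonormalCoeff, ← laguerreNormSq, hG, Nat.cast_choose ℝ hjk]
  nth_rewrite 5 [laguerreNormSq]
  field_simp

theorem ofReal_laguerreOrthonormal {ν : ℝ} (hν : -1 < ν) (k : ℕ) (x : ℝ) :
    (laguerreOrthonormal ν k x : ℂ) = laguerreEntire ν k x := by
  rw [laguerreOrthonormal_eq_sum hν, laguerreEntire]
  push_cast
  rfl

theorem differentiable_laguerreEntire (ν : ℝ) (k : ℕ) : Differentiable ℂ (laguerreEntire ν k) := by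
  unfold laguerreEntire
  fun_prop

theorem laguerreNormSq_succ {ν : ℝ} (hν : -1 < ν) (k : ℕ) :
    laguerreNormSq ν (k + 1) = laguerreNormSq ν k * ((k + ν + 1) / (k + 1)) := by
  have h := natCast_add_nu_pos hν k
  rw [laguerreNormSq, laguerreNormSq, Nat.factorial_succ]
  push_cast
  rw [show (k : ℝ) + 1 + ν + 1 = (k + ν + 1) + 1 by ring, Real.Gamma_add_one h.ne']
  field_simp

/-- Successive ratios (k+ν+1)/(k+1) stay between positive constants: at most 1+|ν|, at least min(1,
1+ν). -/
theorem exists_laguerreNormSq_bounds {ν : ℝ} (hν : -1 < ν) :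
    ∃ B : ℝ, 1 ≤ B ∧ ∀ k : ℕ, laguerreNormSq ν k ≤ B ^ (k + 1) ∧
      (laguerreNormSq ν k)⁻¹ ≤ B ^ (k + 1) := by
  have h0 := laguerreNormSq_pos hν 0
  have hν' : 0 < 1 + ν := by linarith
  set B : ℝ := max (max 1 (laguerreNormSq ν 0)) (max (laguerreNormSq ν 0)⁻¹
    (max (1 + |ν|) (1 + ν)⁻¹)) with hB
  have b1 : 1 ≤ B := by simp [hB]
  have b2 : laguerreNormSq ν 0 ≤ B := by simp [hB]
  have b3 : (laguerreNormSq ν 0)⁻¹ ≤ B := by simp [hB]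
  have b4 : 1 + |ν| ≤ B := by simp [hB]
  have b5 : (1 + ν)⁻¹ ≤ B := by simp [hB]
  refine ⟨B, b1, fun k => ?_⟩
  induction k with
  | zero => simpa using ⟨b2, b3⟩
  | succ k ih =>
    have hk : (0 : ℝ) ≤ k := k.cast_nonneg
    have hp := natCast_add_nu_pos hν k
    have hw := laguerreNormSq_pos hν k
    have hB0 : 0 < B := by linarith
    rw [laguerreNormSq_succ hν, mul_inv, inv_div, pow_succ B (k + 1)]
    refine ⟨mul_le_mul ih.1 (le_trans ?_ b4) (by positivity) (by positivity),
      mul_le_mul ih.2 ?_ (by positivity) (by positivity)⟩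
    · rw [div_le_iff₀ (by positivity)]
      nlinarith [le_abs_self ν, abs_nonneg ν, mul_nonneg hk (abs_nonneg ν)]
    · rw [div_le_iff₀ hp]
      rcases le_total 0 ν with h | h
      · nlinarith
      · have : 1 ≤ B * (1 + ν) := by
          rwa [inv_le_iff_one_le_mul₀ hν'] at b5
        nlinarith

theorem exists_abs_laguerreOrthonormalCoeff_le {ν : ℝ} (hν : -1 < ν) :
    ∃ B : ℝ, 1 ≤ B ∧ ∀ k j : ℕ, j ≤ k →
      |laguerreOrthonormalCoeff ν k j| ≤ B ^ (k + 1) / j.factorial := by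
  obtain ⟨B, hB, h⟩ := exists_laguerreNormSq_bounds hν
  -- One factor B for √(norm²) at k, one for the inverse norm² at j, and 2 for the binomial
  -- coefficient.
  refine ⟨B * B * 2, by nlinarith, fun k j hjk => ?_⟩
  have hB0 : 0 < B := by linarith
  have hsqrt : √(laguerreNormSq ν k) ≤ B ^ (k + 1) := by
    rw [Real.sqrt_le_left (by positivity)]
    refine (h k).1.trans ?_
    have : 1 ≤ B ^ (k + 1) := one_le_pow₀ hB
    nlinarith
  have hw := laguerreNormSq_pos hν j
  have hinv : (laguerreNormSq ν j)⁻¹ ≤ B ^ (k + 1) :=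
    (h j).2.trans (pow_le_pow_right₀ hB (by lia))
  have hch : (k.choose j : ℝ) ≤ 2 ^ (k + 1) := by
    have h1 : k.choose j ≤ 2 ^ k := Nat.choose_le_two_pow k j
    have h2 : 2 ^ k ≤ 2 ^ (k + 1) := Nat.pow_le_pow_right two_pos (by lia)
    exact_mod_cast h1.trans h2
  rw [laguerreOrthonormalCoeff, abs_mul, abs_pow, abs_neg, abs_one, one_pow, one_mul,
    abs_of_nonneg (by positivity), mul_pow, mul_pow, div_eq_mul_inv (√_)]
  gcongr

/-- Inserting η⁻ᵏ ηʲ ≥ 1 for j ≤ k turns the sum of |z|ʲ/j! into a partial sum of e^{η|z|}. Small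
exponential type is thus bought with geometric growth in k, and B does not depend on η. -/
theorem exists_norm_laguerreEntire_le {ν : ℝ} (hν : -1 < ν) :
    ∃ B : ℝ, 1 ≤ B ∧ ∀ (k : ℕ) (z : ℂ) (η : ℝ), 0 < η → η ≤ 1 →
      ‖laguerreEntire ν k z‖ ≤ B * (B / η) ^ k * Real.exp (η * ‖z‖) := by
  obtain ⟨B, hB, h⟩ := exists_abs_laguerreOrthonormalCoeff_le hν
  refine ⟨B, hB, fun k z η hη hη1 => ?_⟩
  have hB0 : 0 < B := by linarith
  calc ‖laguerreEntire ν k z‖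
      ≤ ∑ j ∈ Finset.range (k + 1), B * (B / η) ^ k * ((η * ‖z‖) ^ j / j.factorial) := by
        refine norm_sum_le_of_le _ fun j hj => ?_
        have hjk : j ≤ k := Nat.lt_succ_iff.1 (Finset.mem_range.1 hj)
        rw [norm_mul, norm_pow, Complex.norm_real, Real.norm_eq_abs]
        have h1 : (1 : ℝ) ≤ η⁻¹ ^ k * η ^ j := by
          rw [inv_pow, ← div_eq_inv_mul, one_le_div (by positivity)]
          exact pow_le_pow_of_le_one hη.le hη1 hjk
        calc |laguerreOrthonormalCoeff ν k j| * ‖z‖ ^ j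
            ≤ B ^ (k + 1) / j.factorial * ‖z‖ ^ j * 1 := by
              rw [mul_one]; gcongr; exact h k j hjk
          _ ≤ B ^ (k + 1) / j.factorial * ‖z‖ ^ j * (η⁻¹ ^ k * η ^ j) := by gcongr
          _ = _ := by rw [div_pow, mul_pow, inv_pow, pow_succ]; field_simp
    _ = B * (B / η) ^ k * ∑ j ∈ Finset.range (k + 1), (η * ‖z‖) ^ j / j.factorial := by
        rw [Finset.mul_sum]
    _ ≤ _ := by
        gcongr
        exact Real.sum_le_exp_of_nonneg (by positivity) _

/-! ### Orthonormality through finite differences. -/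

theorem Gamma_add_natCast {s : ℝ} (hs : 0 < s) (n : ℕ) :
    Real.Gamma (s + n) = (ascPochhammer ℝ n).eval s * Real.Gamma s := by
  induction n with
  | zero => simp
  | succ n ih =>
    push_cast
    rw [← add_assoc, Real.Gamma_add_one (by positivity), ih, ascPochhammer_succ_eval]
    ring

/-- Γ(n+j+ν+1)/Γ(j+ν+1) is a rising factorial, a polynomial of degree n in j. The alternating
binomial sum over j is its k-th difference, which vanishes for n < k and is k! for n = k. -/
theorem integral_pow_mul_laguerreOrthonormal {ν : ℝ} (hν : -1 < ν) (n k : ℕ) :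
    ∫ x, x ^ n * laguerreOrthonormal ν k x ∂(laguerreMeasure ν)
      = √(laguerreNormSq ν k) * (-1) ^ k * (fwdDiff 1)^[k] (ascPochhammer ℝ n).eval (ν + 1) := by
  have hint : ∀ j : ℕ, Integrable (fun x : ℝ => laguerreOrthonormalCoeff ν k j * x ^ (n + j))
      (laguerreMeasure ν) := fun j => (integrable_pow_laguerreMeasure hν _).const_mul _
  have hfun : ∀ x : ℝ, x ^ n * laguerreOrthonormal ν k x
      = ∑ j ∈ Finset.range (k + 1), laguerreOrthonormalCoeff ν k j * x ^ (n + j) := by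
    intro x
    rw [laguerreOrthonormal_eq_sum hν, Finset.mul_sum]
    exact Finset.sum_congr rfl fun j _ => by ring
  simp_rw [hfun]
  rw [integral_finsetSum _ fun j _ => hint j, fwdDiff_iter_eq_sum_shift, Finset.mul_sum]
  refine Finset.sum_congr rfl fun j hj => ?_
  have hjk : j ≤ k := Nat.lt_succ_iff.1 (Finset.mem_range.1 hj)
  have hp := natCast_add_nu_pos hν j
  have hΓ := (Real.Gamma_pos_of_pos hp).ne'
  rw [integral_const_mul, integral_pow_laguerreMeasure hν,
    show ((n + j : ℕ) : ℝ) + ν + 1 = (j + ν + 1) + n by push_cast; ring, Gamma_add_natCast hp,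
    laguerreOrthonormalCoeff]
  nth_rewrite 2 [laguerreNormSq]
  have hsgn : (-1 : ℝ) ^ k * (-1) ^ (k - j) = (-1) ^ j := by
    obtain ⟨m, rfl⟩ := Nat.exists_eq_add_of_le hjk
    rw [Nat.add_sub_cancel_left, pow_add, mul_assoc, ← mul_pow]; simp
  simp only [zsmul_eq_mul, nsmul_eq_mul, mul_one]
  push_cast
  rw [← hsgn, show ν + 1 + (j : ℝ) = j + ν + 1 by ring]
  field_simp

theorem integral_pow_mul_laguerreOrthonormal_of_lt {ν : ℝ} (hν : -1 < ν) {n k : ℕ} (h : n < k) :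
    ∫ x, x ^ n * laguerreOrthonormal ν k x ∂(laguerreMeasure ν) = 0 := by
  rw [integral_pow_mul_laguerreOrthonormal hν, Polynomial.fwdDiff_iter_eq_zero_of_degree_lt
    (by rwa [ascPochhammer_natDegree])]
  simp

theorem integral_pow_mul_laguerreOrthonormal_self {ν : ℝ} (hν : -1 < ν) (k : ℕ) :
    ∫ x, x ^ k * laguerreOrthonormal ν k x ∂(laguerreMeasure ν)
      = √(laguerreNormSq ν k) * (-1) ^ k * k.factorial := by
  have := Polynomial.fwdDiff_iter_degree_eq_factorial (ascPochhammer ℝ k)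
  rw [ascPochhammer_natDegree, (monic_ascPochhammer ℝ k).leadingCoeff, one_smul] at this
  rw [integral_pow_mul_laguerreOrthonormal hν, this]
  simp

theorem integrable_pow_mul_laguerreOrthonormal {ν : ℝ} (hν : -1 < ν) (n k : ℕ) :
    Integrable (fun x => x ^ n * laguerreOrthonormal ν k x) (laguerreMeasure ν) := by
  simp_rw [laguerreOrthonormal_eq_sum hν, Finset.mul_sum]
  refine integrable_finsetSum _ fun j _ => ?_
  refine ((integrable_pow_laguerreMeasure hν (n + j)).const_mul
    (laguerreOrthonormalCoeff ν k j)).congr (ae_of_all _ fun x => ?_)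
  simp only []
  ring

theorem integral_laguerreOrthonormal_mul_of_le {ν : ℝ} (hν : -1 < ν) {m k : ℕ} (h : m ≤ k) :
    ∫ x, laguerreOrthonormal ν m x * laguerreOrthonormal ν k x ∂(laguerreMeasure ν)
      = if m = k then 1 else 0 := by
  have hfun : ∀ x : ℝ, laguerreOrthonormal ν m x * laguerreOrthonormal ν k x
      = ∑ j ∈ Finset.range (m + 1),
        laguerreOrthonormalCoeff ν m j * (x ^ j * laguerreOrthonormal ν k x) := by
    intro x
    rw [laguerreOrthonormal_eq_sum hν m, Finset.sum_mul]
    exact Finset.sum_congr rfl fun j _ => by ring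
  simp_rw [hfun]
  rw [integral_finsetSum _ fun j _ => (integrable_pow_mul_laguerreOrthonormal hν j k).const_mul _]
  simp_rw [integral_const_mul]
  rw [Finset.sum_range_succ, Finset.sum_eq_zero, zero_add]
  · split_ifs with hmk
    · subst hmk
      have hw := laguerreNormSq_pos hν m
      have hsq := Real.mul_self_sqrt hw.le
      rw [integral_pow_mul_laguerreOrthonormal_self hν, laguerreOrthonormalCoeff, Nat.choose_self]
      have hsgn : (-1 : ℝ) ^ m * (-1) ^ m = 1 := by rw [← mul_pow]; simp
      calc _ = ((-1 : ℝ) ^ m * (-1) ^ m) * ((√(laguerreNormSq ν m) * √(laguerreNormSq ν m))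
              / laguerreNormSq ν m) := by push_cast; field_simp
        _ = 1 := by rw [hsgn, hsq, div_self hw.ne', one_mul]
    · rw [integral_pow_mul_laguerreOrthonormal_of_lt hν (by lia), mul_zero]
  · intro j hj
    rw [integral_pow_mul_laguerreOrthonormal_of_lt hν
      ((Finset.mem_range.1 hj).trans_le h), mul_zero]

theorem integral_laguerreOrthonormal_mul {ν : ℝ} (hν : -1 < ν) (m k : ℕ) :
    ∫ x, laguerreOrthonormal ν m x * laguerreOrthonormal ν k x ∂(laguerreMeasure ν)
      = if m = k then 1 else 0 := by
  rcases le_total m k with h | h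
  · exact integral_laguerreOrthonormal_mul_of_le hν h
  · simp_rw [mul_comm (laguerreOrthonormal ν m _), eq_comm (a := m)]
    exact integral_laguerreOrthonormal_mul_of_le hν h

/-! ### Square integrability, L¹ bounds and completeness in the Laguerre space. -/

theorem aestronglyMeasurable_comp_ofReal {F : ℂ → ℂ} (hF : Differentiable ℂ F) (ν : ℝ) :
    AEStronglyMeasurable (fun x : ℝ => F x) (laguerreMeasure ν) :=
  (hF.continuous.comp Complex.continuous_ofReal).aestronglyMeasurable

/-- The rate 1/4 leaves room: a product of two such functions is O(e^{x/2}), still integrable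
against e^{-x}. -/
theorem memLp_two_of_norm_le_exp {ν : ℝ} (hν : -1 < ν) {h : ℝ → ℂ} {C : ℝ}
    (hm : AEStronglyMeasurable h (laguerreMeasure ν))
    (hC : ∀ x : ℝ, 0 < x → ‖h x‖ ≤ C * Real.exp (1 / 4 * x)) : MemLp h 2 (laguerreMeasure ν) := by
  have hexp : MemLp (fun x => C * Real.exp (1 / 4 * x)) 2 (laguerreMeasure ν) := by
    refine MemLp.const_mul ?_ C
    rw [memLp_two_iff_integrable_sq (by fun_prop)]
    refine (integrable_exp_laguerreMeasure hν (t := 1 / 2) (by norm_num)).congr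
      (ae_of_all _ fun x => ?_)
    simp only [← Real.exp_nat_mul]
    push_cast
    ring_nf
  refine hexp.mono hm ?_
  filter_upwards [ae_pos_laguerreMeasure ν] with x hx
  exact (hC x hx).trans (le_abs_self _)

theorem memLp_laguerreOrthonormal {ν : ℝ} (hν : -1 < ν) (k : ℕ) :
    MemLp (fun x : ℝ => (laguerreOrthonormal ν k x : ℂ)) 2 (laguerreMeasure ν) := by
  obtain ⟨B, -, h⟩ := exists_norm_laguerreEntire_le hν
  simp_rw [ofReal_laguerreOrthonormal hν]
  refine memLp_two_of_norm_le_exp hν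
    (aestronglyMeasurable_comp_ofReal (differentiable_laguerreEntire ν k) ν)
    (C := B * (B / (1 / 4)) ^ k) fun x hx => ?_
  have := h k x (1 / 4) (by norm_num) (by norm_num)
  rwa [Complex.norm_real, Real.norm_of_nonneg hx.le] at this

theorem integrable_mul_laguerreOrthonormal {ν : ℝ} (hν : -1 < ν) {h : ℝ → ℂ}
    (hh : MemLp h 2 (laguerreMeasure ν)) (k : ℕ) :
    Integrable (fun x : ℝ => h x * (laguerreOrthonormal ν k x : ℂ)) (laguerreMeasure ν) :=
  hh.integrable_mul (memLp_laguerreOrthonormal hν k)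

theorem memLp_ofReal_pow {ν : ℝ} (hν : -1 < ν) (n : ℕ) :
    MemLp (fun x : ℝ => (x : ℂ) ^ n) 2 (laguerreMeasure ν) := by
  rw [← memLp_norm_iff (by fun_prop), memLp_two_iff_integrable_sq (by fun_prop)]
  refine (integrable_pow_laguerreMeasure hν (n * 2)).congr (ae_of_all _ fun x => ?_)
  simp only [norm_pow, Complex.norm_real, Real.norm_eq_abs]
  rw [pow_mul, pow_right_comm |x|, sq_abs, pow_right_comm]

theorem exists_integral_norm_mul_laguerreOrthonormal_le {ν : ℝ} (hν : -1 < ν) :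
    ∃ B : ℝ, 1 ≤ B ∧ ∃ I : ℝ, 0 ≤ I ∧ ∀ (k : ℕ) (C : ℝ) (h : ℝ → ℂ),
      (∀ x : ℝ, 0 < x → ‖h x‖ ≤ C * Real.exp (1 / 4 * x)) →
      ∫ x, ‖h x * (laguerreOrthonormal ν k x : ℂ)‖ ∂(laguerreMeasure ν) ≤ C * I * B ^ k := by
  obtain ⟨B, hB, hL⟩ := exists_norm_laguerreEntire_le hν
  refine ⟨B / (1 / 4), by linarith, B * ∫ x, Real.exp (1 / 2 * x) ∂(laguerreMeasure ν),
    mul_nonneg (by linarith) (integral_nonneg fun x => (Real.exp_pos _).le),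
    fun k C h hC => ?_⟩
  have hi := (integrable_exp_laguerreMeasure hν (t := 1 / 2) (by norm_num)).const_mul
    (C * B * (B / (1 / 4)) ^ k)
  calc _ ≤ ∫ x, C * B * (B / (1 / 4)) ^ k * Real.exp (1 / 2 * x) ∂(laguerreMeasure ν) := by
        refine integral_mono_of_nonneg (ae_of_all _ fun x => norm_nonneg _) hi ?_
        filter_upwards [ae_pos_laguerreMeasure ν] with x hx
        have h1 := hL k x (1 / 4) (by norm_num) (by norm_num)
        rw [Complex.norm_real, Real.norm_of_nonneg hx.le] at h1
        rw [norm_mul, ofReal_laguerreOrthonormal hν]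
        calc _ ≤ (C * Real.exp (1 / 4 * x)) * (B * (B / (1 / 4)) ^ k * Real.exp (1 / 4 * x)) :=
              mul_le_mul (hC x hx) h1 (norm_nonneg _) ((norm_nonneg _).trans (hC x hx))
          _ = C * B * (B / (1 / 4)) ^ k * (Real.exp (1 / 4 * x) * Real.exp (1 / 4 * x)) := by ring
          _ = _ := by rw [← Real.exp_add]; ring_nf
    _ = _ := by rw [integral_const_mul]; ring

/-- The orthonormal Laguerre polynomials are complete in `L²((0,∞), x^ν e^{-x} dx)`. -/
theorem ae_eq_zero_of_laguerreCoeff_eq_zero {ν : ℝ} (hν : -1 < ν) {g : ℝ → ℂ}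
    (hg : MemLp g 2 (laguerreMeasure ν)) (h : ∀ k, laguerreCoeff ν g k = 0) :
    g =ᵐ[laguerreMeasure ν] 0 := by
  have hfin := isFiniteMeasure_laguerreMeasure hν
  have hi : ∀ n : ℕ, Integrable (fun x : ℝ => (x : ℂ) ^ n * g x) (laguerreMeasure ν) :=
    fun n => (memLp_ofReal_pow hν n).integrable_mul hg
  refine ae_eq_zero_of_moments one_pos (fun t ht => integrable_exp_laguerreMeasure hν ht.2) hg hi
    fun n => ?_
  -- The passage from monomials to Laguerre polynomials is triangular with nonzero diagonal, so the
  -- n-th moment follows from the earlier ones.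
  induction n using Nat.strong_induction_on with
  | _ n ih =>
    have hn := h n
    have hfun : ∀ x : ℝ, g x * (laguerreOrthonormal ν n x : ℂ) = ∑ j ∈ Finset.range (n + 1),
        (laguerreOrthonormalCoeff ν n j : ℂ) * ((x : ℂ) ^ j * g x) := by
      intro x
      rw [ofReal_laguerreOrthonormal hν, laguerreEntire, Finset.mul_sum]
      exact Finset.sum_congr rfl fun j _ => by ring
    rw [laguerreCoeff_eq] at hn
    simp_rw [hfun] at hn
    rw [integral_finsetSum _ fun j _ => (hi j).const_mul _] at hn
    simp_rw [integral_const_mul] at hn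
    rw [Finset.sum_range_succ, Finset.sum_eq_zero
      (fun j hj => by rw [ih j (Finset.mem_range.1 hj), mul_zero]), zero_add] at hn
    refine (mul_eq_zero.1 hn).resolve_left ?_
    have hw := laguerreNormSq_pos hν n
    rw [← ne_eq, Complex.ofReal_ne_zero, laguerreOrthonormalCoeff, Nat.choose_self]
    have := Real.sqrt_pos.2 hw
    exact mul_ne_zero (pow_ne_zero _ (by norm_num)) (by positivity)

theorem laguerreCoeff_sub {ν : ℝ} (hν : -1 < ν) {f g : ℝ → ℂ}
    (hf : MemLp f 2 (laguerreMeasure ν)) (hg : MemLp g 2 (laguerreMeasure ν)) (k : ℕ) :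
    laguerreCoeff ν (f - g) k = laguerreCoeff ν f k - laguerreCoeff ν g k := by
  simp_rw [laguerreCoeff_eq]
  rw [← integral_sub (integrable_mul_laguerreOrthonormal hν hf k)
    (integrable_mul_laguerreOrthonormal hν hg k)]
  simp only [Pi.sub_apply, sub_mul]

theorem laguerreCoeff_congr_ae {ν : ℝ} {f g : ℝ → ℂ} (h : f =ᵐ[laguerreMeasure ν] g) (k : ℕ) :
    laguerreCoeff ν f k = laguerreCoeff ν g k := by
  simp_rw [laguerreCoeff_eq]
  refine integral_congr_ae ?_
  filter_upwards [h] with x hx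
  rw [hx]

/-! ### From entire functions of minimal type to coefficient decay. -/

/-- The derivatives at `0` of an entire function of minimal exponential type decay faster than any
geometric sequence. -/
theorem exists_norm_iteratedDeriv_zero_le {F : ℂ → ℂ} (hF : Differentiable ℂ F)
    (hg : ∀ ε : ℝ, 0 < ε → ∃ C : ℝ, ∀ z : ℂ, ‖F z‖ ≤ C * Real.exp (ε * ‖z‖)) {η : ℝ} (hη : 0 < η) :
    ∃ C : ℝ, 0 ≤ C ∧ ∀ n : ℕ, ‖iteratedDeriv n F 0‖ ≤ C * η ^ n := by
  -- Cauchy's estimate on radius (n+1)/ε gives n! εⁿ C e^{n+1}/(n+1)ⁿ ≤ C e (eε)ⁿ, and eε = η. Using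
  -- n+1 keeps the radius positive at n = 0.
  set ε : ℝ := η / Real.exp 1 with hε
  have hε0 : 0 < ε := by positivity
  obtain ⟨C, hC⟩ := hg ε hε0
  have hC0 : 0 ≤ C := by simpa using (norm_nonneg _).trans (hC 0)
  refine ⟨C * Real.exp 1, by positivity, fun n => ?_⟩
  have hR : 0 < ((n : ℝ) + 1) / ε := by positivity
  have hsph : ∀ z ∈ Metric.sphere (0 : ℂ) (((n : ℝ) + 1) / ε),
      ‖F z‖ ≤ C * Real.exp ((n : ℝ) + 1) := by
    intro z hz
    have := hC z
    rwa [mem_sphere_zero_iff_norm.1 hz, mul_div_cancel₀ _ hε0.ne'] at this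
  refine (Complex.norm_iteratedDeriv_le_of_forall_mem_sphere_norm_le n hR hF.diffContOnCl
    hsph).trans ?_
  have hfac : (n.factorial : ℝ) ≤ ((n : ℝ) + 1) ^ n := by
    have := Nat.factorial_le_pow n
    calc (n.factorial : ℝ) ≤ (n : ℝ) ^ n := by exact_mod_cast this
      _ ≤ _ := by gcongr; linarith
  have hexp : Real.exp ((n : ℝ) + 1) = Real.exp 1 ^ n * Real.exp 1 := by
    rw [Real.exp_add, ← Real.exp_nat_mul, mul_one]
  rw [div_le_iff₀ (by positivity), div_pow, hexp, hε, div_pow]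
  calc _ ≤ ((n : ℝ) + 1) ^ n * (C * (Real.exp 1 ^ n * Real.exp 1)) := by gcongr
    _ = _ := by field_simp

/-- For n ≥ k, δⁿ ≤ δ^k comes out of the sum; what remains is a tail of the series of e^{|z|/4}. -/
theorem norm_sub_taylor_le {F : ℂ → ℂ} (hF : Differentiable ℂ F) {C δ : ℝ} (hC : 0 ≤ C)
    (hδ : 0 < δ) (hδ1 : δ ≤ 1) (h : ∀ n : ℕ, ‖iteratedDeriv n F 0‖ ≤ C * (1 / 4 * δ) ^ n) (k : ℕ)
    (z : ℂ) :
    ‖F z - ∑ n ∈ Finset.range k, (n.factorial : ℂ)⁻¹ * iteratedDeriv n F 0 * z ^ n‖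
      ≤ C * δ ^ k * Real.exp (1 / 4 * ‖z‖) := by
  have hs := Complex.hasSum_taylorSeries_of_entire hF 0 z
  simp only [sub_zero, smul_eq_mul] at hs
  have hs' : HasSum (fun n : ℕ => (n.factorial : ℂ)⁻¹ * iteratedDeriv n F 0 * z ^ n) (F z) := by
    refine hs.congr_fun ?_
    intro n
    ring
  have hs'' := (hasSum_nat_add_iff' k).2 hs'
  have he : HasSum (fun n : ℕ => (1 / 4 * ‖z‖) ^ n / n.factorial) (Real.exp (1 / 4 * ‖z‖)) := by
    rw [Real.exp_eq_exp_ℝ]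
    exact NormedSpace.expSeries_div_hasSum_exp _
  have he' := ((hasSum_nat_add_iff' k).2 he).mul_left (C * δ ^ k)
  rw [← hs''.tsum_eq]
  refine (tsum_of_norm_bounded he' fun n => ?_).trans ?_
  · rw [norm_mul, norm_mul, norm_inv, norm_pow, Complex.norm_natCast]
    have hpow : δ ^ (n + k) ≤ δ ^ k := pow_le_pow_of_le_one hδ.le hδ1 (by lia)
    calc _ ≤ ((n + k).factorial : ℝ)⁻¹ * (C * (1 / 4 * δ) ^ (n + k)) * ‖z‖ ^ (n + k) := by
          gcongr; exact h _
      _ = C * δ ^ (n + k) * ((1 / 4 * ‖z‖) ^ (n + k) / (n + k).factorial) := by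
          rw [mul_pow, mul_pow]; field_simp
      _ ≤ _ := by gcongr
  · gcongr
    simp only [sub_le_self_iff]
    positivity

theorem integral_ofReal_pow_mul_laguerreOrthonormal_of_lt {ν : ℝ} (hν : -1 < ν) {n k : ℕ}
    (h : n < k) :
    ∫ x : ℝ, (x : ℂ) ^ n * (laguerreOrthonormal ν k x : ℂ) ∂(laguerreMeasure ν) = 0 := by
  have := congrArg (fun r : ℝ => (r : ℂ)) (integral_pow_mul_laguerreOrthonormal_of_lt hν h)
  simp only [← integral_complex_ofReal, Complex.ofReal_zero] at this
  rw [← this]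
  push_cast
  rfl

theorem norm_comp_ofReal_le {F : ℂ → ℂ} {C ε : ℝ} (h : ∀ z, ‖F z‖ ≤ C * Real.exp (ε * ‖z‖)) {x : ℝ}
    (hx : 0 < x) : ‖F x‖ ≤ C * Real.exp (ε * x) := by
  have := h x
  rwa [Complex.norm_real, Real.norm_of_nonneg hx.le] at this

/-- The Fourier-Laguerre coefficients of an entire function of minimal exponential type decay
faster than any geometric sequence. -/
theorem exists_norm_laguerreCoeff_le {ν : ℝ} (hν : -1 < ν) {F : ℂ → ℂ} (hF : Differentiable ℂ F)
    (hg : ∀ ε : ℝ, 0 < ε → ∃ C : ℝ, ∀ z : ℂ, ‖F z‖ ≤ C * Real.exp (ε * ‖z‖)) {θ : ℝ} (hθ : 1 < θ) :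
    ∃ K : ℝ, ∀ k : ℕ, ‖laguerreCoeff ν (fun x : ℝ => F x) k‖ ≤ K * θ⁻¹ ^ k := by
  obtain ⟨B, hB, I, hI, hint⟩ := exists_integral_norm_mul_laguerreOrthonormal_le hν
  have hθ0 : 0 < θ := by linarith
  have hB0 : 0 < B := by linarith
  -- δ^k cancels the B^k of the L¹ bound and leaves θ⁻ᵏ.
  set δ : ℝ := (B * θ)⁻¹ with hδ
  have hδ0 : 0 < δ := by positivity
  have hδ1 : δ ≤ 1 := inv_le_one_of_one_le₀ (by nlinarith)
  obtain ⟨C, hC0, hC⟩ := exists_norm_iteratedDeriv_zero_le hF hg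
    (show 0 < 1 / 4 * δ by positivity)
  refine ⟨C * I, fun k => ?_⟩
  obtain ⟨C', hC'⟩ := hg (1 / 4) (by norm_num)
  have hFm : MemLp (fun x : ℝ => F x) 2 (laguerreMeasure ν) :=
    memLp_two_of_norm_le_exp hν (aestronglyMeasurable_comp_ofReal hF ν)
      fun x hx => norm_comp_ofReal_le hC' hx
  have hpi : ∀ n : ℕ, Integrable (fun x : ℝ => (n.factorial : ℂ)⁻¹ * iteratedDeriv n F 0 *
      ((x : ℂ) ^ n * (laguerreOrthonormal ν k x : ℂ))) (laguerreMeasure ν) :=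
    fun n => (integrable_mul_laguerreOrthonormal hν (memLp_ofReal_pow hν n) k).const_mul _
  have hT : ∫ x : ℝ, (∑ n ∈ Finset.range k, (n.factorial : ℂ)⁻¹ * iteratedDeriv n F 0 * (x : ℂ) ^ n)
      * (laguerreOrthonormal ν k x : ℂ) ∂(laguerreMeasure ν) = 0 := by
    simp_rw [Finset.sum_mul, mul_assoc _ (_ ^ _) _]
    rw [integral_finsetSum _ fun n _ => hpi n]
    refine Finset.sum_eq_zero fun n hn => ?_
    rw [integral_const_mul, integral_ofReal_pow_mul_laguerreOrthonormal_of_lt hν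
      (Finset.mem_range.1 hn), mul_zero]
  have hTi : Integrable (fun x : ℝ => (∑ n ∈ Finset.range k, (n.factorial : ℂ)⁻¹ *
      iteratedDeriv n F 0 * (x : ℂ) ^ n) * (laguerreOrthonormal ν k x : ℂ))
      (laguerreMeasure ν) := by
    simp_rw [Finset.sum_mul, mul_assoc _ (_ ^ _) _]
    exact integrable_finsetSum _ fun n _ => hpi n
  rw [laguerreCoeff_eq, ← sub_zero (∫ x, _ ∂_), ← hT,
    ← integral_sub (integrable_mul_laguerreOrthonormal hν hFm k) hTi]
  simp_rw [← sub_mul]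
  refine (norm_integral_le_integral_norm _).trans ((hint k (C * δ ^ k) _ fun x hx => ?_).trans_eq ?_)
  · have := norm_sub_taylor_le hF hC0 hδ0 hδ1 hC k x
    rwa [Complex.norm_real, Real.norm_of_nonneg hx.le] at this
  · rw [hδ, mul_inv, mul_pow, inv_pow B]
    field_simp

/-! ### From coefficient decay to an entire function of minimal type. -/

theorem summable_of_norm_le_geometric {a : ℕ → ℂ} {K θ : ℝ} (hθ : 1 < θ)
    (h : ∀ k, ‖a k‖ ≤ K * θ⁻¹ ^ k) : Summable fun k => ‖a k‖ ^ 2 * θ ^ k := by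
  have hθ0 : 0 < θ := by linarith
  refine Summable.of_nonneg_of_le (fun k => by positivity) (fun k => ?_)
    ((summable_geometric_of_lt_one (inv_nonneg.2 hθ0.le) (inv_lt_one_of_one_lt₀ hθ)).mul_left
      (K ^ 2))
  calc ‖a k‖ ^ 2 * θ ^ k ≤ (K * θ⁻¹ ^ k) ^ 2 * θ ^ k := by
        have := h k
        gcongr
    _ = _ := by rw [inv_pow]; field_simp

theorem exists_norm_le_geometric {a : ℕ → ℂ}
    (h : ∀ θ : ℝ, 1 < θ → Summable fun k => ‖a k‖ ^ 2 * θ ^ k) {q : ℝ} (hq : 1 < q) :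
    ∃ K : ℝ, 0 ≤ K ∧ ∀ k, ‖a k‖ ≤ K * q⁻¹ ^ k := by
  have hq0 : 0 < q := by linarith
  -- Taking θ = q² and bounding each term by the whole sum gives the rate q⁻ᵏ after a square root.
  have hs := h (q ^ 2) (one_lt_pow₀ hq two_ne_zero)
  refine ⟨√(∑' k, ‖a k‖ ^ 2 * (q ^ 2) ^ k), Real.sqrt_nonneg _, fun k => ?_⟩
  have hle := hs.le_tsum k fun j _ => by positivity
  rw [inv_pow, ← div_eq_mul_inv, le_div_iff₀ (by positivity)]
  refine Real.le_sqrt_of_sq_le (le_of_eq_of_le ?_ hle)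
  rw [mul_pow]; ring

theorem exists_norm_mul_laguerreEntire_le {ν : ℝ} (hν : -1 < ν) {a : ℕ → ℂ}
    (h : ∀ θ : ℝ, 1 < θ → Summable fun k => ‖a k‖ ^ 2 * θ ^ k) {η : ℝ} (hη : 0 < η) :
    ∃ K : ℝ, ∀ (k : ℕ) (z : ℂ),
      ‖a k * laguerreEntire ν k z‖ ≤ K * Real.exp (η * ‖z‖) * (1 / 2) ^ k := by
  wlog hη1 : η ≤ 1 generalizing η
  · obtain ⟨K, hK⟩ := this one_pos le_rfl
    have hK0 : 0 ≤ K := by simpa using (norm_nonneg _).trans (hK 0 0)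
    refine ⟨K, fun k z => (hK k z).trans ?_⟩
    gcongr
    exact (not_le.1 hη1).le
  obtain ⟨B, hB, hL⟩ := exists_norm_laguerreEntire_le hν
  have hB0 : 0 < B := by linarith
  -- The decay rate 2B/η beats the growth (B/η)^k and leaves (1/2)^k for the M-test.
  have hq : 1 < 2 * (B / η) := by
    have : 1 ≤ B / η := (one_le_div hη).2 (hη1.trans hB)
    linarith
  obtain ⟨K, hK0, hK⟩ := exists_norm_le_geometric h hq
  refine ⟨K * B, fun k z => ?_⟩
  rw [norm_mul]
  calc _ ≤ (K * (2 * (B / η))⁻¹ ^ k) * (B * (B / η) ^ k * Real.exp (η * ‖z‖)) := by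
        gcongr
        exacts [hK k, hL k z η hη hη1]
    _ = _ := by rw [inv_pow, mul_pow, one_div, inv_pow]; field_simp

/-- A Fourier-Laguerre series whose coefficients decay faster than any geometric sequence. -/
noncomputable def laguerreSeries (ν : ℝ) (a : ℕ → ℂ) (z : ℂ) : ℂ := ∑' k, a k * laguerreEntire ν k z

section Series

variable {ν : ℝ} {a : ℕ → ℂ}

theorem exists_norm_laguerreSeries_le (hν : -1 < ν)
    (h : ∀ θ : ℝ, 1 < θ → Summable fun k => ‖a k‖ ^ 2 * θ ^ k) {ε : ℝ} (hε : 0 < ε) :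
    ∃ C : ℝ, ∀ z : ℂ, ‖laguerreSeries ν a z‖ ≤ C * Real.exp (ε * ‖z‖) := by
  obtain ⟨K, hK⟩ := exists_norm_mul_laguerreEntire_le hν h hε
  refine ⟨K * 2, fun z => ?_⟩
  refine (tsum_of_norm_bounded (hasSum_geometric_two.mul_left _) fun k => hK k z).trans_eq ?_
  ring

theorem differentiable_laguerreSeries (hν : -1 < ν)
    (h : ∀ θ : ℝ, 1 < θ → Summable fun k => ‖a k‖ ^ 2 * θ ^ k) :
    Differentiable ℂ (laguerreSeries ν a) := by
  obtain ⟨K, hK⟩ := exists_norm_mul_laguerreEntire_le hν h one_pos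
  have hK0 : 0 ≤ K := by simpa using (norm_nonneg _).trans (hK 0 0)
  intro z
  have hz : z ∈ Metric.ball (0 : ℂ) (‖z‖ + 1) := by simp
  have hsum : Summable fun k : ℕ => K * Real.exp (1 * (‖z‖ + 1)) * (1 / 2 : ℝ) ^ k :=
    summable_geometric_two.mul_left _
  refine (Complex.differentiableOn_tsum_of_summable_norm hsum
    (fun k => ((differentiable_laguerreEntire ν k).const_mul (a k)).differentiableOn)
    Metric.isOpen_ball fun k w hw => (hK k w).trans ?_).differentiableAt
    (Metric.isOpen_ball.mem_nhds hz)
  have := (mem_ball_zero_iff.1 hw).le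
  gcongr

/-- The L¹ norms of the terms are summable, so the series may be integrated termwise; orthonormality
then leaves only k = m. -/
theorem laguerreCoeff_laguerreSeries (hν : -1 < ν)
    (h : ∀ θ : ℝ, 1 < θ → Summable fun k => ‖a k‖ ^ 2 * θ ^ k) (m : ℕ) :
    laguerreCoeff ν (fun x : ℝ => laguerreSeries ν a x) m = a m := by
  obtain ⟨K, hK⟩ := exists_norm_mul_laguerreEntire_le hν h (show (0 : ℝ) < 1 / 4 by norm_num)
  obtain ⟨B, hB, I, hI, hint⟩ := exists_integral_norm_mul_laguerreOrthonormal_le hν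
  have hterm : ∀ k, Integrable (fun x : ℝ => a k * laguerreEntire ν k x *
      (laguerreOrthonormal ν m x : ℂ)) (laguerreMeasure ν) := by
    intro k
    simp_rw [← ofReal_laguerreOrthonormal hν]
    exact integrable_mul_laguerreOrthonormal hν
      ((memLp_laguerreOrthonormal hν k).const_mul (a k)) m
  have hs : Summable fun k => ∫ x : ℝ, ‖a k * laguerreEntire ν k x *
      (laguerreOrthonormal ν m x : ℂ)‖ ∂(laguerreMeasure ν) := by
    refine Summable.of_nonneg_of_le (fun k => integral_nonneg fun x => norm_nonneg _)
      (fun k => (hint m (K * (1 / 2) ^ k) _ fun x hx => ?_).trans_eq ?_)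
      (summable_geometric_two.mul_left (K * I * B ^ m))
    · have := hK k x
      rw [Complex.norm_real, Real.norm_of_nonneg hx.le] at this
      linarith
    · ring
  have key := hasSum_integral_of_summable_integral_norm hterm hs
  have hval : ∀ k, ∫ x : ℝ, a k * laguerreEntire ν k x *
      (laguerreOrthonormal ν m x : ℂ) ∂(laguerreMeasure ν) = if k = m then a m else 0 := by
    intro k
    simp_rw [← ofReal_laguerreOrthonormal hν, mul_assoc, ← Complex.ofReal_mul]
    rw [integral_const_mul, integral_complex_ofReal, integral_laguerreOrthonormal_mul hν]
    split_ifs with hkm <;> simp [hkm]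
  simp_rw [hval, tsum_mul_right] at key
  rw [laguerreCoeff_eq]
  exact key.unique (hasSum_ite_eq m (a m))

end Series

/-! ### The equivalence. -/

theorem mainTheorem10 (ν : ℝ) (hν : -1 < ν) (f : ℝ → ℂ) :
    (MemLp f 2 (laguerreMeasure ν) ∧
        ∀ θ : ℝ, 1 < θ → Summable fun k : ℕ => ‖laguerreCoeff ν f k‖ ^ 2 * θ ^ k) ↔
      ∃ F : ℂ → ℂ, Differentiable ℂ F ∧
        (∀ ε : ℝ, 0 < ε → ∃ C : ℝ, ∀ z : ℂ, ‖F z‖ ≤ C * Real.exp (ε * ‖z‖)) ∧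
        ∀ᵐ x : ℝ ∂(volume.restrict (Ioi 0)), f x = F (x : ℂ) := by
  have hmem : ∀ {F : ℂ → ℂ}, Differentiable ℂ F →
      (∀ ε : ℝ, 0 < ε → ∃ C : ℝ, ∀ z : ℂ, ‖F z‖ ≤ C * Real.exp (ε * ‖z‖)) →
      MemLp (fun x : ℝ => F x) 2 (laguerreMeasure ν) := fun hF hg => by
    obtain ⟨C, hC⟩ := hg (1 / 4) (by norm_num)
    exact memLp_two_of_norm_le_exp hν (aestronglyMeasurable_comp_ofReal hF ν)
      fun x hx => norm_comp_ofReal_le hC hx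
  constructor
  · rintro ⟨hf, hs⟩
    have hF := differentiable_laguerreSeries hν hs
    have hg := fun ε (hε : (0 : ℝ) < ε) => exists_norm_laguerreSeries_le hν hs hε
    refine ⟨laguerreSeries ν (laguerreCoeff ν f), hF, hg, ?_⟩
    have hz := ae_eq_zero_of_laguerreCoeff_eq_zero hν (hf.sub (hmem hF hg)) fun k => by
      rw [laguerreCoeff_sub hν hf (hmem hF hg), laguerreCoeff_laguerreSeries hν hs, sub_self]
    rw [← ae_laguerreMeasure_iff ν]
    filter_upwards [hz] with x hx
    exact sub_eq_zero.1 hx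
  · rintro ⟨F, hF, hg, hfF⟩
    have hae : f =ᵐ[laguerreMeasure ν] fun x : ℝ => F x := (ae_laguerreMeasure_iff ν).2 hfF
    refine ⟨(hmem hF hg).ae_eq hae.symm, fun θ hθ => ?_⟩
    obtain ⟨K, hK⟩ := exists_norm_laguerreCoeff_le hν hF hg hθ
    simp_rw [laguerreCoeff_congr_ae hae]
    exact summable_of_norm_le_geometric hθ hK
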